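/- Let $N\ge 0$ and let $\mathcal{O}_N$ denote either the ring $\mathbb{k}[[T_1,\dots,T_N]]$ of formal power series over a field $\mathbb{k}$, or the ring $\mathbb{k}\{T_1,\dots,T_N\}$ of convergent power series over a field $\mathbb{k}$ with an absolute value (those series that converge absolutely on some polydisc of positive radius). Let $\mathfrak{m}$ be its maximal ideal and $\mathrm{ord}$ the $\mathfrak{m}$-adic order on $\mathcal{O}_N$, with values in $\mathbb{N}\cup\{\infty\}$ ($\mathrm{ord}(0)=\infty$). For an ideal $I$ of $\mathcal{O}_N$ and $g\in\mathcal{O}_N$, let $\nu_I(g)\in\mathbb{N}\cup\{\infty\}$ be the order of the class of $g$ in $\mathcal{O}_N/I$ with respect to the maximal ideal of $\mathcal{O}_N/I$, that is, $\nu_I(g)=\sup\{i : g\in I+\mathfrak{m}^i\}$. The initial form of a nonzero series is its homogeneous component of lowest degree, a polynomial in $\mathbb{k}[T_1,\dots,T_N]$. Let $I=(f_1,\dots,f_n)$ be an ideal of $\mathcal{O}_N$, and suppose that the ideal of $\mathbb{k}[T_1,\dots,T_N]$ generated by the initial forms of the nonzero elements of $I$ is prime and a complete intersection (generated by a regular sequence).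 Then $$\nu_I(gh)\le 2\bigl(\nu_I(g)+\nu_I(h)\bigr)+3\max_{1\le k\le n}\mathrm{ord}(f_k)\qquad\text{for all } g,h\in\mathcal{O}_N,$$ where the maximum is $0$ if $n=0$. -/

import Mathlib

noncomputable section

namespace ArtinIzumi

/-- The `J`-adic order of `x`: the largest `n` with `x ∈ J ^ n`, and `∞` if `x` lies in every
power of `J`. -/
def adicOrder {R : Type*} [CommRing R] (J : Ideal R) (x : R) : ℕ∞ :=
  ⨆ (n : ℕ) (_ : x ∈ J ^ n), (n : ℕ∞)

/-- `ord`: the order on a local ring with respect to its maximal ideal. -/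
def ord {R : Type*} [CommRing R] [IsLocalRing R] (x : R) : ℕ∞ :=
  adicOrder (IsLocalRing.maximalIdeal R) x

/-- `ν_I`: the order of the class of `x` in `R ⧸ I` with respect to the image in `R ⧸ I` of the
maximal ideal of `R` (which is the maximal ideal of `R ⧸ I` when `I` is proper). -/
def nu {R : Type*} [CommRing R] [IsLocalRing R] (I : Ideal R) (x : R) : ℕ∞ :=
  adicOrder ((IsLocalRing.maximalIdeal R).map (Ideal.Quotient.mk I)) (Ideal.Quotient.mk I x)

/-- The initial form of a formal power series: its homogeneous component of lowest degree, as a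
polynomial (`0` for the zero series). -/
def initialForm {N : ℕ} {K : Type*} [Field K] (f : MvPowerSeries (Fin N) K) :
    MvPolynomial (Fin N) K :=
  (f.homogeneousComponent f.order.toNat).truncTotal (f.order.toNat + 1)

/-- The ideal of the polynomial ring generated by the initial forms of the elements of `S`. -/
def initialIdeal {N : ℕ} {K : Type*} [Field K] (S : Set (MvPowerSeries (Fin N) K)) :
    Ideal (MvPolynomial (Fin N) K) :=
  Ideal.span (initialForm '' S)

/-- An ideal is a complete intersection if it is generated by a regular sequence. -/
def IsCompleteIntersection {R : Type*} [CommRing R] (J : Ideal R) : Prop :=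
  ∃ rs : List R, RingTheory.Sequence.IsRegular R rs ∧ Ideal.ofList rs = J

section Convergent

variable {N : ℕ} {K : Type*} [NormedField K]

/-- A formal power series over a field with an absolute value is convergent if it converges
absolutely on some polydisc of positive radius. -/
def IsConvergent (f : MvPowerSeries (Fin N) K) : Prop :=
  ∃ r : ℝ, 0 < r ∧ Summable fun d : Fin N →₀ ℕ => ‖MvPowerSeries.coeff d f‖ * r ^ d.degree

theorem summable_of_le {f : MvPowerSeries (Fin N) K} {r s : ℝ} (hs : 0 < s) (hsr : s ≤ r)
    (h : Summable fun d : Fin N →₀ ℕ => ‖MvPowerSeries.coeff d f‖ * r ^ d.degree) :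
    Summable fun d : Fin N →₀ ℕ => ‖MvPowerSeries.coeff d f‖ * s ^ d.degree := by
  refine Summable.of_nonneg_of_le (fun d => by positivity) (fun d => ?_) h
  gcongr

theorem IsConvergent.exists_common {f g : MvPowerSeries (Fin N) K} (hf : IsConvergent f)
    (hg : IsConvergent g) : ∃ r : ℝ, 0 < r ∧
      (Summable fun d : Fin N →₀ ℕ => ‖MvPowerSeries.coeff d f‖ * r ^ d.degree) ∧
      Summable fun d : Fin N →₀ ℕ => ‖MvPowerSeries.coeff d g‖ * r ^ d.degree := by
  obtain ⟨r, hr, hfr⟩ := hf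
  obtain ⟨s, hs, hgs⟩ := hg
  have hm : 0 < min r s := lt_min hr hs
  exact ⟨min r s, hm, summable_of_le hm (min_le_left _ _) hfr,
    summable_of_le hm (min_le_right _ _) hgs⟩

theorem IsConvergent.add {f g : MvPowerSeries (Fin N) K} (hf : IsConvergent f)
    (hg : IsConvergent g) : IsConvergent (f + g) := by
  obtain ⟨r, hr, h1, h2⟩ := hf.exists_common hg
  refine ⟨r, hr, Summable.of_nonneg_of_le (fun d => by positivity) (fun d => ?_) (h1.add h2)⟩
  rw [map_add, ← add_mul]
  gcongr
  exact norm_add_le _ _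

theorem norm_coeff_mul_le (f g : MvPowerSeries (Fin N) K) {r : ℝ} (hr : 0 < r)
    (d : Fin N →₀ ℕ) : ‖MvPowerSeries.coeff d (f * g)‖ * r ^ d.degree ≤
      ∑ p ∈ Finset.HasAntidiagonal.antidiagonal d, (‖MvPowerSeries.coeff p.1 f‖ * r ^ p.1.degree) *
        (‖MvPowerSeries.coeff p.2 g‖ * r ^ p.2.degree) := by
  rw [MvPowerSeries.coeff_mul]
  refine (mul_le_mul_of_nonneg_right (norm_sum_le _ _) (by positivity)).trans ?_
  rw [Finset.sum_mul]
  refine Finset.sum_le_sum fun p hp => le_of_eq ?_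
  rw [← Finset.HasAntidiagonal.mem_antidiagonal.mp hp, map_add, pow_add, norm_mul]
  ring

theorem IsConvergent.mul {f g : MvPowerSeries (Fin N) K} (hf : IsConvergent f)
    (hg : IsConvergent g) : IsConvergent (f * g) := by
  obtain ⟨r, hr, h1, h2⟩ := hf.exists_common hg
  refine ⟨r, hr, Summable.of_nonneg_of_le (fun d => by positivity)
    (norm_coeff_mul_le f g hr) ?_⟩
  have h3 := Summable.mul_of_nonneg h1 h2 (fun d => by positivity) (fun d => by positivity)
  exact summable_sum_mul_antidiagonal_of_summable_mul
    (f := fun d : Fin N →₀ ℕ => ‖MvPowerSeries.coeff d f‖ * r ^ d.degree)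
    (g := fun d : Fin N →₀ ℕ => ‖MvPowerSeries.coeff d g‖ * r ^ d.degree) h3

theorem isConvergent_C (a : K) :
    IsConvergent (MvPowerSeries.C a : MvPowerSeries (Fin N) K) := by
  classical
  refine ⟨1, one_pos, summable_of_ne_finset_zero (s := {0}) fun d hd => ?_⟩
  rw [MvPowerSeries.coeff_C, if_neg (by simpa using hd)]
  simp

variable (N K) in
/-- The ring of convergent power series in `N` variables over a field with an absolute value. -/
def Conv : Subalgebra K (MvPowerSeries (Fin N) K) where
  carrier := {f | IsConvergent f}
  mul_mem' := fun hf hg => hf.mul hg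
  add_mem' := fun hf hg => hf.add hg
  algebraMap_mem' := fun a => isConvergent_C a

theorem exists_radius_le_half {v : MvPowerSeries (Fin N) K} (hv : IsConvergent v)
    (hv0 : MvPowerSeries.constantCoeff v = 0) : ∃ s : ℝ, 0 < s ∧
      ∀ A : Finset (Fin N →₀ ℕ),
        ∑ d ∈ A, ‖MvPowerSeries.coeff d v‖ * s ^ d.degree ≤ 1 / 2 := by
  obtain ⟨r, hr, h⟩ := hv
  set S : ℝ := ∑' d : Fin N →₀ ℕ, ‖MvPowerSeries.coeff d v‖ * r ^ d.degree with hS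
  have hS0 : 0 ≤ S := tsum_nonneg fun d => by positivity
  set t : ℝ := 1 / (2 * (S + 1)) with ht
  have ht0 : 0 < t := by positivity
  have ht1 : t ≤ 1 := by
    rw [ht, div_le_one (by positivity)]
    linarith
  have htS : t * S ≤ 1 / 2 := by
    rw [ht, div_mul_eq_mul_div, div_le_div_iff₀ (by positivity) (by norm_num)]
    linarith
  refine ⟨t * r, by positivity, fun A => ?_⟩
  have key : ∀ d : Fin N →₀ ℕ, ‖MvPowerSeries.coeff d v‖ * (t * r) ^ d.degree ≤
      t * (‖MvPowerSeries.coeff d v‖ * r ^ d.degree) := by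
    intro d
    by_cases hd : d = 0
    · subst hd
      have : MvPowerSeries.coeff (0 : Fin N →₀ ℕ) v = 0 := hv0
      simp [this]
    · have hdeg : d.degree ≠ 0 := by
        rwa [Ne, Finsupp.degree_eq_zero_iff]
      have : t ^ d.degree ≤ t := pow_le_of_le_one ht0.le ht1 hdeg
      calc ‖MvPowerSeries.coeff d v‖ * (t * r) ^ d.degree
          = t ^ d.degree * (‖MvPowerSeries.coeff d v‖ * r ^ d.degree) := by ring
        _ ≤ t * (‖MvPowerSeries.coeff d v‖ * r ^ d.degree) := by gcongr
  calc ∑ d ∈ A, ‖MvPowerSeries.coeff d v‖ * (t * r) ^ d.degree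
      ≤ ∑ d ∈ A, t * (‖MvPowerSeries.coeff d v‖ * r ^ d.degree) :=
        Finset.sum_le_sum fun d _ => key d
    _ = t * ∑ d ∈ A, ‖MvPowerSeries.coeff d v‖ * r ^ d.degree := by rw [Finset.mul_sum]
    _ ≤ t * S := by
        gcongr
        exact h.sum_le_tsum A fun d _ => by positivity
    _ ≤ 1 / 2 := htS

theorem IsConvergent.of_mul_eq_one {f g : MvPowerSeries (Fin N) K} (hf : IsConvergent f)
    (hf1 : MvPowerSeries.constantCoeff f = 1) (hfg : f * g = 1) : IsConvergent g := by
  classical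
  have hv : IsConvergent (f - 1) := by
    have := hf.add (isConvergent_C (N := N) (-1 : K))
    rwa [map_neg, map_one, ← sub_eq_add_neg] at this
  obtain ⟨s, hs, hA⟩ := exists_radius_le_half hv (by simp [hf1])
  set V : (Fin N →₀ ℕ) → ℝ := fun d => ‖MvPowerSeries.coeff d (f - 1)‖ * s ^ d.degree with hV
  set G : (Fin N →₀ ℕ) → ℝ := fun d => ‖MvPowerSeries.coeff d g‖ * s ^ d.degree with hG
  have hV0 : ∀ d, 0 ≤ V d := fun d => by positivity
  have hG0 : ∀ d, 0 ≤ G d := fun d => by positivity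
  have hg : g = 1 - (f - 1) * g := by rw [sub_mul, hfg]; ring
  have hGd : ∀ d, G d ≤ (if d = 0 then 1 else 0) +
      ∑ p ∈ Finset.HasAntidiagonal.antidiagonal d, V p.1 * G p.2 := by
    intro d
    have h1 : ‖MvPowerSeries.coeff d g‖ ≤
        ‖MvPowerSeries.coeff d (1 : MvPowerSeries (Fin N) K)‖ +
          ‖MvPowerSeries.coeff d ((f - 1) * g)‖ := by
      conv_lhs => rw [hg, map_sub]
      exact norm_sub_le _ _
    have h2 : ‖MvPowerSeries.coeff d (1 : MvPowerSeries (Fin N) K)‖ * s ^ d.degree =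
        if d = 0 then 1 else 0 := by
      rw [MvPowerSeries.coeff_one]
      split_ifs with hd
      · subst hd; simp
      · simp
    calc G d ≤ (‖MvPowerSeries.coeff d (1 : MvPowerSeries (Fin N) K)‖ +
          ‖MvPowerSeries.coeff d ((f - 1) * g)‖) * s ^ d.degree := by
          simp only [hG]; gcongr
      _ ≤ _ := by
          rw [add_mul, h2]
          gcongr
          exact norm_coeff_mul_le (f - 1) g hs d
  have hbox : ∀ m : Fin N →₀ ℕ, ∑ d ∈ Finset.Iic m, G d ≤ 2 := by
    intro m
    have h1 : ∑ d ∈ Finset.Iic m, ∑ p ∈ Finset.HasAntidiagonal.antidiagonal d, V p.1 * G p.2 ≤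
        (∑ d ∈ Finset.Iic m, V d) * ∑ d ∈ Finset.Iic m, G d := by
      rw [Finset.sum_mul_sum, ← Finset.sum_product', ← Finset.sum_biUnion]
      · refine Finset.sum_le_sum_of_subset_of_nonneg ?_
          fun p _ _ => mul_nonneg (hV0 _) (hG0 _)
        intro p hp
        simp only [Finset.mem_biUnion, Finset.mem_Iic, Finset.HasAntidiagonal.mem_antidiagonal] at hp
        obtain ⟨d, hd, rfl⟩ := hp
        simp only [Finset.mem_product, Finset.mem_Iic]
        exact ⟨le_self_add.trans hd, le_add_self.trans hd⟩
      · intro a _ b _ hab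
        refine Finset.disjoint_left.mpr fun p hp hq => hab ?_
        rw [← Finset.HasAntidiagonal.mem_antidiagonal.mp hp, ← Finset.HasAntidiagonal.mem_antidiagonal.mp hq]
    have h2 : ∑ d ∈ Finset.Iic m, G d ≤ 1 +
        (∑ d ∈ Finset.Iic m, V d) * ∑ d ∈ Finset.Iic m, G d := by
      refine (Finset.sum_le_sum fun d _ => hGd d).trans ?_
      rw [Finset.sum_add_distrib]
      refine add_le_add (le_of_eq ?_) h1
      rw [Finset.sum_ite_eq' (Finset.Iic m) (0 : Fin N →₀ ℕ), if_pos (by simp)]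
    have h3 : ∑ d ∈ Finset.Iic m, V d ≤ 1 / 2 := hA _
    have h4 : 0 ≤ ∑ d ∈ Finset.Iic m, G d := Finset.sum_nonneg fun d _ => hG0 d
    nlinarith
  refine ⟨s, hs, summable_of_sum_le (c := 2) hG0 fun A => ?_⟩
  refine (Finset.sum_le_sum_of_subset_of_nonneg ?_ fun d _ _ => hG0 d).trans (hbox (A.sup id))
  intro d hd
  exact Finset.mem_Iic.mpr (Finset.le_sup (f := id) hd)

theorem isUnit_conv {f : Conv N K}
    (hf : MvPowerSeries.constantCoeff (f : MvPowerSeries (Fin N) K) ≠ 0) : IsUnit f := by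
  set c := MvPowerSeries.constantCoeff (f : MvPowerSeries (Fin N) K) with hc
  set F : MvPowerSeries (Fin N) K :=
    MvPowerSeries.C c⁻¹ * (f : MvPowerSeries (Fin N) K) with hF
  have hF1 : MvPowerSeries.constantCoeff F = 1 := by
    rw [hF, map_mul, ← hc, MvPowerSeries.constantCoeff_C, inv_mul_cancel₀ hf]
  have hFc : IsConvergent F := (isConvergent_C _).mul f.2
  have hinv : F * F⁻¹ = 1 := MvPowerSeries.mul_inv_cancel F (by rw [hF1]; exact one_ne_zero)
  have hG : IsConvergent (MvPowerSeries.C c⁻¹ * F⁻¹) :=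
    (isConvergent_C _).mul (hFc.of_mul_eq_one hF1 hinv)
  refine IsUnit.of_mul_eq_one (⟨_, hG⟩ : Conv N K) (Subtype.ext ?_)
  change (f : MvPowerSeries (Fin N) K) * (MvPowerSeries.C c⁻¹ * F⁻¹) = 1
  rw [← hinv, hF]
  ring

instance : IsLocalRing (Conv N K) :=
  IsLocalRing.of_isUnit_or_isUnit_one_sub_self fun f => by
    by_cases hf : MvPowerSeries.constantCoeff (f : MvPowerSeries (Fin N) K) = 0
    · right
      refine isUnit_conv ?_
      change MvPowerSeries.constantCoeff (1 - (f : MvPowerSeries (Fin N) K)) ≠ 0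
      rw [map_sub, map_one, hf, sub_zero]
      exact one_ne_zero
    · exact Or.inl (isUnit_conv hf)

end Convergent

end ArtinIzumi

end

/-!
Since `𝔪 ^ i` consists of the series of order at least `i`, the graded ring of `𝒪 ⧸ I` is the
quotient of the polynomial ring by the ideal `J` generated by the initial forms of the elements
of `I`. When `J` is prime this graded ring is a domain, so initial forms modulo `I` multiply and
`ν_I(g * h) ≤ ν_I(g) + ν_I(h)`; this is stronger than the required inequality.

Formal and convergent power series are treated together, through an injective homomorphism `φ`
from a local ring to the ring of formal power series. The image has to contain the polynomials and
to be closed under taking parts of a series divisible by a variable and dividing them by it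
(`HasPartialQuotients`). The latter identifies the powers of the maximal ideal with the order
filtration (`mem_maximalIdeal_pow_iff`). The two other ingredients are that each homogeneous part
of an element of `J` is the homogeneous part of an element of `I` of at least that order
(`exists_homogeneousComponent_eq_of_mem_initialIdeal`), and the argument with graded pieces itself
(`nu_mul_le`).
-/

noncomputable section

namespace ArtinIzumi

open MvPowerSeries

/-! ### The adic order -/

section AdicOrder

variable {R : Type*} [CommRing R]

theorem adicOrder_le_iff {J : Ideal R} {x : R} {n : ℕ} :
    adicOrder J x ≤ n ↔ x ∉ J ^ (n + 1) := by
  constructor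
  · intro h hx
    have h1 : ((n + 1 : ℕ) : ℕ∞) ≤ adicOrder J x :=
      le_iSup₂ (f := fun (k : ℕ) (_ : x ∈ J ^ k) => (k : ℕ∞)) (n + 1) hx
    have h2 := h1.trans h
    rw [Nat.cast_le] at h2
    omega
  · intro h
    refine iSup₂_le fun k hk => ?_
    rw [Nat.cast_le]
    by_contra! hlt
    exact h (Ideal.pow_le_pow_right hlt hk)

theorem mem_pow_of_adicOrder_eq {J : Ideal R} {x : R} {n : ℕ} (h : adicOrder J x = n) :
    x ∈ J ^ n := by
  cases n with
  | zero => simp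
  | succ k =>
    by_contra hx
    have h1 := adicOrder_le_iff.mpr hx
    rw [h, Nat.cast_le] at h1
    omega

theorem mk_mem_map_pow_iff {I J : Ideal R} {x : R} {n : ℕ} :
    Ideal.Quotient.mk I x ∈ (J.map (Ideal.Quotient.mk I)) ^ n ↔ ∃ y ∈ I, x - y ∈ J ^ n := by
  rw [← Ideal.map_pow, Ideal.mem_map_iff_of_surjective _ Ideal.Quotient.mk_surjective]
  constructor
  · rintro ⟨z, hz, hzx⟩
    refine ⟨x - z, Ideal.Quotient.eq.mp hzx.symm, ?_⟩
    simpa using hz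
  · rintro ⟨y, hy, hxy⟩
    refine ⟨x - y, hxy, ?_⟩
    rw [map_sub, Ideal.Quotient.eq_zero_iff_mem.mpr hy, sub_zero]

end AdicOrder

variable {N : ℕ} {K : Type*} [Field K]

/-! ### Homogeneous parts of power series -/

/-- The homogeneous component of degree `a` of a power series, as a polynomial. -/
def homogeneousPart (a : ℕ) (f : MvPowerSeries (Fin N) K) : MvPolynomial (Fin N) K :=
  (f.homogeneousComponent a).truncTotal (a + 1)

theorem coe_homogeneousPart (a : ℕ) (f : MvPowerSeries (Fin N) K) :
    (homogeneousPart a f : MvPowerSeries (Fin N) K) = f.homogeneousComponent a := by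
  ext d
  rw [MvPolynomial.coeff_coe, homogeneousPart, coeff_truncTotal_eq_ite,
    coeff_homogeneousComponent]
  split_ifs <;> first | rfl | omega

theorem homogeneousComponent_homogeneousComponent (a : ℕ) (f : MvPowerSeries (Fin N) K) :
    (f.homogeneousComponent a).homogeneousComponent a = f.homogeneousComponent a := by
  ext d
  simp only [coeff_homogeneousComponent]
  split_ifs <;> rfl

theorem initialForm_eq_homogeneousPart {f : MvPowerSeries (Fin N) K} {a : ℕ}
    (h : f.order = a) : initialForm f = homogeneousPart a f := by
  rw [initialForm, h]
  rfl

theorem succ_le_order_of_homogeneousComponent_eq_zero {f : MvPowerSeries (Fin N) K} {a : ℕ}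
    (h : (a : ℕ∞) ≤ f.order) (h0 : f.homogeneousComponent a = 0) :
    ((a + 1 : ℕ) : ℕ∞) ≤ f.order := by
  refine nat_le_order fun d hd => ?_
  rcases Nat.lt_succ_iff_lt_or_eq.mp hd with hlt | heq
  · exact coeff_of_lt_order (lt_of_lt_of_le (by exact_mod_cast hlt) h)
  · have := congrArg (coeff d) h0
    rwa [coeff_homogeneousComponent, if_pos heq] at this

theorem le_order_sub {f g : MvPowerSeries (Fin N) K} {a : ℕ∞} (hf : a ≤ f.order)
    (hg : a ≤ g.order) : a ≤ (f - g).order := by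
  rw [sub_eq_add_neg]
  exact (le_min hf (by rwa [order_neg])).trans min_order_le_add

section Lift

variable {A : Type*} [CommRing A] (φ : A →+* MvPowerSeries (Fin N) K)

/-- The homogeneous parts of the elements of the initial ideal are again initial forms, or zero:
this uses that homogeneous polynomials lift to the ring `A`. -/
theorem exists_homogeneousComponent_eq_of_mem_initialIdeal
    (hpoly : ∀ p : MvPolynomial (Fin N) K, ∃ x, φ x = p) (I : Ideal A)
    {p : MvPolynomial (Fin N) K} (hp : p ∈ initialIdeal (φ '' I)) (a : ℕ) :
    ∃ x ∈ I, (a : ℕ∞) ≤ (φ x).order ∧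
      (φ x).homogeneousComponent a = (p : MvPowerSeries (Fin N) K).homogeneousComponent a := by
  induction hp using Submodule.span_induction generalizing a with
  | mem q hq =>
    obtain ⟨_, ⟨x, hx, rfl⟩, rfl⟩ := hq
    have hform : (initialForm (φ x) : MvPowerSeries (Fin N) K) =
        (φ x).homogeneousComponent (φ x).order.toNat := coe_homogeneousPart _ _
    by_cases ha : (φ x).order = a
    · refine ⟨x, hx, ha.ge, ?_⟩
      rw [hform, ha, ENat.toNat_natCast, homogeneousComponent_homogeneousComponent]
    · refine ⟨0, I.zero_mem, by simp, ?_⟩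
      rw [hform, map_zero, map_zero]
      by_cases hx0 : φ x = 0
      · simp [hx0]
      · have hne : (φ x).order.toNat ≠ a := fun h => ha (by
          rw [← h, ne_zero_iff_order_finite.mp hx0])
        ext d
        simp only [coeff_homogeneousComponent, map_zero]
        split_ifs <;> first | rfl | omega
  | zero => exact ⟨0, I.zero_mem, by simp, by simp⟩
  | add q r _ _ hq hr =>
    obtain ⟨x, hx, hxa, hxc⟩ := hq a
    obtain ⟨y, hy, hya, hyc⟩ := hr a
    refine ⟨x + y, I.add_mem hx hy, ?_, ?_⟩
    · rw [map_add]
      exact (le_min hxa hya).trans min_order_le_add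
    · rw [map_add, map_add, hxc, hyc, MvPolynomial.coe_add, map_add]
  | smul s q _ hq =>
    rw [smul_eq_mul]
    induction s using MvPolynomial.induction_on generalizing q a with
    | C c =>
      obtain ⟨x, hx, hxa, hxc⟩ := hq a
      obtain ⟨y, hy⟩ := hpoly (MvPolynomial.C c)
      refine ⟨y * x, I.mul_mem_left y hx, ?_, ?_⟩
      · rw [map_mul]
        exact hxa.trans (le_add_self.trans le_order_mul)
      · rw [map_mul, hy, MvPolynomial.coe_mul, MvPolynomial.coe_C, ← smul_eq_C_mul,
          ← smul_eq_C_mul, map_smul, map_smul, hxc]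
    | add s t hs ht =>
      obtain ⟨x, hx, hxa, hxc⟩ := hs q ‹_› hq a
      obtain ⟨y, hy, hya, hyc⟩ := ht q ‹_› hq a
      refine ⟨x + y, I.add_mem hx hy, ?_, ?_⟩
      · rw [map_add]
        exact (le_min hxa hya).trans min_order_le_add
      · rw [map_add, map_add, hxc, hyc, add_mul, MvPolynomial.coe_add, map_add]
    | mul_X s j hs =>
      rw [mul_assoc]
      refine hs _ (Ideal.mul_mem_left _ _ ‹_›) (fun b => ?_) a
      have hX : ((1 : ℕ) : ℕ∞) ≤ (X j : MvPowerSeries (Fin N) K).order := by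
        rw [Nat.cast_one, one_le_order_iff_constCoeff_eq_zero, constantCoeff_X]
      rw [MvPolynomial.coe_mul, MvPolynomial.coe_X]
      cases b with
      | zero =>
        refine ⟨0, I.zero_mem, by simp, ?_⟩
        rw [map_zero, map_zero, homogeneousComponent_of_lt_order_eq_zero]
        exact lt_of_lt_of_le (by simp) ((le_add_right hX).trans le_order_mul)
      | succ b =>
        obtain ⟨x, hx, hxb, hxc⟩ := hq b
        obtain ⟨y, hy⟩ := hpoly (MvPolynomial.X j)
        rw [MvPolynomial.coe_X] at hy
        refine ⟨y * x, I.mul_mem_left y hx, ?_, ?_⟩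
        · rw [map_mul, hy, add_comm, Nat.cast_add]
          exact (add_le_add hX hxb).trans le_order_mul
        · ext d
          have hd : ∀ F : MvPowerSeries (Fin N) K,
              coeff d ((X j * F).homogeneousComponent (b + 1)) =
                if Finsupp.single j 1 ≤ d then
                  coeff (d - Finsupp.single j 1) (F.homogeneousComponent b) else 0 := by
            intro F
            rw [coeff_homogeneousComponent, X, coeff_monomial_mul]
            by_cases hle : Finsupp.single j 1 ≤ d
            · obtain ⟨e, rfl⟩ := exists_add_of_le hle
              simp [coeff_homogeneousComponent, add_comm 1]
            · simp [hle]
          rw [map_mul, hy, hd, hd, hxc]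

/-! ### Powers of the maximal ideal -/

/-- The image of `φ` contains, with every series `f`, the series obtained from `f` by selecting
some of its terms divisible by a variable and dividing these by that variable. -/
def HasPartialQuotients : Prop :=
  ∀ (x : A) (j : Fin N) (F : MvPowerSeries (Fin N) K),
    (∀ d, coeff d F = 0 ∨ coeff d F = coeff (d + Finsupp.single j 1) (φ x)) → ∃ y, φ y = F

/-- A series without constant term is a combination of the variables: each nonconstant term is
divided by the first variable that occurs in it. -/
theorem exists_eq_sum_X_mul {f : MvPowerSeries (Fin N) K} (hf : constantCoeff f = 0) :
    ∃ F : Fin N → MvPowerSeries (Fin N) K,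
      (∀ j d, coeff d (F j) = 0 ∨ coeff d (F j) = coeff (d + Finsupp.single j 1) f) ∧
      f = ∑ j, X j * F j := by
  classical
  obtain ⟨F, hF⟩ : ∃ F : Fin N → MvPowerSeries (Fin N) K, ∀ j d, coeff d (F j) =
      if ∀ l < j, d l = 0 then coeff (d + Finsupp.single j 1) f else 0 :=
    ⟨fun j d => if ∀ l < j, d l = 0 then coeff (d + Finsupp.single j 1) f else 0,
      fun _ _ => rfl⟩
  refine ⟨F, fun j d => ?_, ?_⟩
  · rw [hF]
    split_ifs
    · exact Or.inr rfl
    · exact Or.inl rfl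
  · ext d
    rw [map_sum]
    by_cases hd : d = 0
    · subst hd
      rw [Finset.sum_eq_zero fun j _ => coeff_zero_X_mul (F j) j]
      exact hf
    · have hne : (d.support).Nonempty := Finsupp.support_nonempty_iff.mpr hd
      set j := d.support.min' hne with hj
      have hdj : d j ≠ 0 := Finsupp.mem_support_iff.mp (d.support.min'_mem hne)
      have hlt : ∀ l < j, d l = 0 := fun l hl => by
        by_contra h
        exact absurd (d.support.min'_le l (Finsupp.mem_support_iff.mpr h)) (not_le.mpr hl)
      rw [Finset.sum_eq_single j]
      · have hle : Finsupp.single j 1 ≤ d := by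
          rw [Finsupp.single_le_iff]
          omega
        rw [X, coeff_monomial_mul, if_pos hle, one_mul, hF, if_pos,
          tsub_add_cancel_of_le hle]
        intro l hl
        rw [Finsupp.tsub_apply, hlt l hl, Nat.zero_sub]
      · intro k _ hkj
        rw [X, coeff_monomial_mul]
        split_ifs with hle
        · rw [one_mul, hF, if_neg]
          rw [Finsupp.single_le_iff] at hle
          have hjk : j < k := lt_of_le_of_ne
            (d.support.min'_le k (Finsupp.mem_support_iff.mpr (by omega))) hkj.symm
          intro h
          have := h j hjk
          rw [Finsupp.tsub_apply, Finsupp.single_apply, if_neg hkj, Nat.sub_zero] at this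
          exact hdj this
        · rfl
      · simp

variable [IsLocalRing A]

theorem mem_maximalIdeal_pow_iff (hinj : Function.Injective φ)
    (hunit : ∀ x, constantCoeff (φ x) ≠ 0 → IsUnit x)
    (hpoly : ∀ p : MvPolynomial (Fin N) K, ∃ x, φ x = p) (hquot : HasPartialQuotients φ)
    (n : ℕ) (x : A) :
    x ∈ IsLocalRing.maximalIdeal A ^ n ↔ (n : ℕ∞) ≤ (φ x).order := by
  have hmem : ∀ x, x ∈ IsLocalRing.maximalIdeal A ↔ constantCoeff (φ x) = 0 := by
    intro x
    rw [IsLocalRing.mem_maximalIdeal, mem_nonunits_iff]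
    refine ⟨fun h => by_contra fun h0 => h (hunit x h0), fun h0 hx => ?_⟩
    have := (hx.map φ).map (constantCoeff (σ := Fin N) (R := K))
    rw [h0] at this
    exact not_isUnit_zero this
  induction n generalizing x with
  | zero => simp
  | succ n ih =>
    constructor
    · intro hx
      rw [pow_succ] at hx
      induction hx using Submodule.mul_induction_on' with
      | mem_mul_mem y hy z hz =>
        rw [map_mul, Nat.cast_add, Nat.cast_one]
        exact (add_le_add ((ih y).mp hy)
          (one_le_order_iff_constCoeff_eq_zero.mpr ((hmem z).mp hz))).trans le_order_mul
      | add y _ z _ hy hz =>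
        rw [map_add]
        exact (le_min hy hz).trans min_order_le_add
    · intro hx
      have hx0 : constantCoeff (φ x) = 0 := by
        rw [← one_le_order_iff_constCoeff_eq_zero]
        exact le_trans (by simp) hx
      obtain ⟨F, hF, hsum⟩ := exists_eq_sum_X_mul hx0
      choose y hy using fun j => hquot x j (F j) (hF j)
      choose t ht using fun j : Fin N => hpoly (MvPolynomial.X j)
      simp only [MvPolynomial.coe_X] at ht
      have hxy : x = ∑ j, t j * y j := hinj (by
        rw [map_sum, hsum]
        simp [hy, ht])
      rw [hxy, pow_succ']
      refine Ideal.sum_mem _ fun j _ => Ideal.mul_mem_mul ?_ ?_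
      · rw [hmem, ht, constantCoeff_X]
      · refine (ih (y j)).mpr ?_
        rw [hy]
        refine nat_le_order fun d hd => ?_
        rcases hF j d with h | h
        · exact h
        · rw [h]
          refine coeff_of_lt_order (lt_of_lt_of_le ?_ hx)
          rw [Nat.cast_lt, map_add, Finsupp.degree_single]
          omega

/-! ### The order modulo an ideal with prime initial ideal -/

theorem nu_mul_le (hinj : Function.Injective φ)
    (hunit : ∀ x, constantCoeff (φ x) ≠ 0 → IsUnit x)
    (hpoly : ∀ p : MvPolynomial (Fin N) K, ∃ x, φ x = p) (hquot : HasPartialQuotients φ)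
    (I : Ideal A) (hI : (initialIdeal (φ '' I)).IsPrime) (g h : A) :
    nu I (g * h) ≤ nu I g + nu I h := by
  have hpow := mem_maximalIdeal_pow_iff φ hinj hunit hpoly hquot
  -- If the leading part of a representative of `g` lies in the initial ideal, then it is the
  -- leading part of an element of `I`, and subtracting that element raises the order.
  have key : ∀ {a : ℕ} {g i : A}, nu I g = a → i ∈ I → (a : ℕ∞) ≤ (φ (g - i)).order →
      homogeneousPart a (φ (g - i)) ∉ initialIdeal (φ '' I) := by
    intro a g i hg hi hord hmem
    obtain ⟨x, hx, hxa, hxc⟩ :=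
      exists_homogeneousComponent_eq_of_mem_initialIdeal φ hpoly I hmem a
    rw [coe_homogeneousPart, homogeneousComponent_homogeneousComponent] at hxc
    refine adicOrder_le_iff.mp (le_of_eq hg)
      (mk_mem_map_pow_iff.mpr ⟨i + x, I.add_mem hi hx, ?_⟩)
    rw [hpow, ← sub_sub, map_sub]
    exact succ_le_order_of_homogeneousComponent_eq_zero (le_order_sub hord hxa)
      (by rw [map_sub, hxc, sub_self])
  by_cases hg : nu I g = ⊤
  · simp [hg]
  by_cases hh : nu I h = ⊤
  · simp [hh]
  obtain ⟨a, ha⟩ := ENat.ne_top_iff_exists.mp hg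
  obtain ⟨b, hb⟩ := ENat.ne_top_iff_exists.mp hh
  obtain ⟨i, hi, hgi⟩ := mk_mem_map_pow_iff.mp (mem_pow_of_adicOrder_eq ha.symm)
  obtain ⟨j, hj, hhj⟩ := mk_mem_map_pow_iff.mp (mem_pow_of_adicOrder_eq hb.symm)
  rw [hpow] at hgi hhj
  rw [← ha, ← hb, ← Nat.cast_add]
  refine adicOrder_le_iff.mpr fun hmem => ?_
  obtain ⟨k, hk, hghk⟩ := mk_mem_map_pow_iff.mp hmem
  rw [hpow] at hghk
  -- The product of the two representatives is congruent to `y ∈ I` modulo terms of order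
  -- greater than `a + b`.
  set y : A := k - (g * j + i * h - i * j) with hydef
  have hy : y ∈ I := I.sub_mem hk (I.sub_mem
    (I.add_mem (I.mul_mem_left _ hj) (I.mul_mem_right _ hi)) (I.mul_mem_left _ hj))
  have hdiff : φ (g - i) * φ (h - j) = φ y + φ (g * h - k) := by
    rw [← map_mul, ← map_add]
    congr 1
    rw [hydef]
    ring
  have hprod : ((a + b : ℕ) : ℕ∞) ≤ (φ (g - i) * φ (h - j)).order := by
    rw [Nat.cast_add]
    exact (add_le_add hgi hhj).trans le_order_mul
  have hlt : ((a + b : ℕ) : ℕ∞) < (φ (g * h - k)).order :=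
    lt_of_lt_of_le (by exact_mod_cast Nat.lt_succ_self _) hghk
  have hyord : ((a + b : ℕ) : ℕ∞) ≤ (φ y).order := by
    rw [← add_sub_cancel_right (φ y) (φ (g * h - k)), ← hdiff]
    exact le_order_sub hprod hlt.le
  have hcomp : (φ y).homogeneousComponent (a + b) =
      (φ (g - i)).homogeneousComponent a * (φ (h - j)).homogeneousComponent b := by
    rw [← homogeneousComponent_mul_of_le_order hgi hhj, hdiff, map_add,
      homogeneousComponent_of_lt_order_eq_zero hlt, add_zero]
  have hpart : homogeneousPart (a + b) (φ y) =
      homogeneousPart a (φ (g - i)) * homogeneousPart b (φ (h - j)) := by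
    apply MvPolynomial.coe_injective (σ := Fin N) (R := K)
    rw [MvPolynomial.coe_mul, coe_homogeneousPart, coe_homogeneousPart, coe_homogeneousPart, hcomp]
  have hin : homogeneousPart (a + b) (φ y) ∈ initialIdeal (φ '' I) := by
    by_cases h0 : (φ y).order = (a + b : ℕ)
    · rw [← initialForm_eq_homogeneousPart h0]
      exact Ideal.subset_span ⟨φ y, ⟨y, hy, rfl⟩, rfl⟩
    · have : homogeneousPart (a + b) (φ y) = 0 := by
        apply MvPolynomial.coe_injective (σ := Fin N) (R := K)
        rw [coe_homogeneousPart, MvPolynomial.coe_zero]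
        exact homogeneousComponent_of_lt_order_eq_zero (lt_of_le_of_ne hyord (Ne.symm h0))
      rw [this]
      exact Ideal.zero_mem _
  rw [hpart] at hin
  rcases hI.mem_or_mem hin with h1 | h1
  · exact key ha.symm hi hgi h1
  · exact key hb.symm hj hhj h1

end Lift

/-! ### Formal and convergent power series -/

theorem hasPartialQuotients_conv (N : ℕ) (K : Type*) [NormedField K] :
    HasPartialQuotients (A := Conv N K) (Conv N K).val.toRingHom := by
  intro x j F hF
  obtain ⟨r, hr, hs⟩ := x.2
  refine ⟨⟨F, r, hr, ?_⟩, rfl⟩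
  have hs' := (hs.comp_injective (add_left_injective (Finsupp.single j 1))).mul_left r⁻¹
  refine Summable.of_nonneg_of_le (fun d => by positivity) (fun d => ?_) hs'
  have hnorm : ‖coeff d F‖ ≤
      ‖coeff (d + Finsupp.single j 1) (x : MvPowerSeries (Fin N) K)‖ := by
    rcases hF d with h | h
    · rw [h, norm_zero]
      exact norm_nonneg _
    · rw [h]
      rfl
  calc ‖coeff d F‖ * r ^ d.degree
      ≤ ‖coeff (d + Finsupp.single j 1) (x : MvPowerSeries (Fin N) K)‖ * r ^ d.degree := by
        gcongr
    _ = _ := by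
        simp only [Function.comp_apply, map_add, Finsupp.degree_single, pow_succ]
        field_simp

theorem isConvergent_coe {N : ℕ} {K : Type*} [NormedField K] (p : MvPolynomial (Fin N) K) :
    IsConvergent (p : MvPowerSeries (Fin N) K) := by
  refine ⟨1, one_pos, summable_of_ne_finset_zero (s := p.support) fun d hd => ?_⟩
  rw [MvPolynomial.coeff_coe, MvPolynomial.notMem_support_iff.mp hd, norm_zero, zero_mul]

theorem le_two_mul_add_three_mul (x y : ℕ∞) : x ≤ 2 * x + 3 * y :=
  (le_mul_of_one_le_left' one_le_two).trans le_self_add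

end ArtinIzumi

end

theorem mainTheorem11 (N n : ℕ) :
    (∀ (K : Type*) [Field K] (f : Fin n → MvPowerSeries (Fin N) K)
        (I : Ideal (MvPowerSeries (Fin N) K)),
      I = Ideal.span (Set.range f) →
      (ArtinIzumi.initialIdeal (I : Set (MvPowerSeries (Fin N) K))).IsPrime →
      ArtinIzumi.IsCompleteIntersection
        (ArtinIzumi.initialIdeal (I : Set (MvPowerSeries (Fin N) K))) →
      ∀ g h : MvPowerSeries (Fin N) K,
        ArtinIzumi.nu I (g * h) ≤
          2 * (ArtinIzumi.nu I g + ArtinIzumi.nu I h) + 3 * ⨆ k, ArtinIzumi.ord (f k)) ∧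
    (∀ (K : Type*) [NormedField K] (f : Fin n → ArtinIzumi.Conv N K)
        (I : Ideal (ArtinIzumi.Conv N K)),
      I = Ideal.span (Set.range f) →
      (ArtinIzumi.initialIdeal
        (((↑) : ArtinIzumi.Conv N K → MvPowerSeries (Fin N) K) '' I)).IsPrime →
      ArtinIzumi.IsCompleteIntersection (ArtinIzumi.initialIdeal
        (((↑) : ArtinIzumi.Conv N K → MvPowerSeries (Fin N) K) '' I)) →
      ∀ g h : ArtinIzumi.Conv N K,
        ArtinIzumi.nu I (g * h) ≤
          2 * (ArtinIzumi.nu I g + ArtinIzumi.nu I h) + 3 * ⨆ k, ArtinIzumi.ord (f k)) := by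
  constructor
  · intro K _ f I _ hI _ g h
    have hI' : (ArtinIzumi.initialIdeal
        (RingHom.id (MvPowerSeries (Fin N) K) '' (I : Set (MvPowerSeries (Fin N) K)))).IsPrime := by
      simpa using hI
    have key := ArtinIzumi.nu_mul_le (RingHom.id (MvPowerSeries (Fin N) K)) Function.injective_id
      (fun x hx => MvPowerSeries.isUnit_iff_constantCoeff.mpr (isUnit_iff_ne_zero.mpr hx))
      (fun p => ⟨(p : MvPowerSeries (Fin N) K), rfl⟩) (fun _ _ F _ => ⟨F, rfl⟩) I hI' g h
    exact key.trans (ArtinIzumi.le_two_mul_add_three_mul _ _)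
  · intro K _ f I _ hI _ g h
    have key := ArtinIzumi.nu_mul_le (A := ArtinIzumi.Conv N K)
      (ArtinIzumi.Conv N K).val.toRingHom Subtype.val_injective
      (fun _ hx => ArtinIzumi.isUnit_conv hx)
      (fun p => ⟨⟨(p : MvPowerSeries (Fin N) K), ArtinIzumi.isConvergent_coe p⟩, rfl⟩)
      (ArtinIzumi.hasPartialQuotients_conv N K) I hI g h
    exact key.trans (ArtinIzumi.le_two_mul_add_three_mul _ _)
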